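/- Let $d\ge 1$ be square-free and $q=e^{2\pi i/d}$. Let $PF_2$ and $PF_\infty$ be the parafermion algebras of degree $d$: the unital complex $*$-algebras generated by $c_1,c_2$, respectively by $c_1,c_2,c_3,\dots$, subject to $c_jc_k=q\,c_kc_j$ for $j<k$, $c_j^d=1$ and $c_j^*=c_j^{-1}$. They are graded by $\mathbb Z/d$, with every $c_j$ of degree $1$. A state is a linear functional $\varphi$ with $\varphi(x^*x)\ge 0$ for all $x$ and $\varphi(1)=1$; it is called neutral if it vanishes on all elements of nonzero degree. For $k\ge 1$ let $\iota_k:PF_2\to PF_\infty$ be the homomorphism with $c_1\mapsto c_{2k-1}$ and $c_2\mapsto c_{2k}$. For a state $\rho$ on $PF_2$, the product state $\rho^{\otimes\infty}$ is the state on $PF_\infty$ with $$\rho^{\otimes\infty}\bigl(\iota_1(x_1)\,\iota_2(x_2)\cdots\iota_n(x_n)\bigr)=\rho(x_1)\,\rho(x_2)\cdots\rho(x_n)\qquad(n\ge 0,\ x_1,\dots,x_n\in PF_2).$$ Let $\rho,\tau$ be distinct neutral states on $PF_2$. Then the product states $\rho^{\otimes\infty}$ and $\tau^{\otimes\infty}$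 exist and are unique, and for the state $\varphi'=\tfrac12\bigl(\rho^{\otimes\infty}+\tau^{\otimes\infty}\bigr)$ on $PF_\infty$ the von Neumann algebra $\pi_{\varphi'}(PF_\infty)''$ generated by the GNS representation $\pi_{\varphi'}$ of $PF_\infty$ is not a factor, that is, its center is not $\mathbb C\cdot 1$. -/

import Mathlib

noncomputable section

/-! ### States on unital complex *-algebras and the GNS construction -/

section GNS

open scoped ComplexOrder InnerProductSpace
open UniformSpace

/-- A state on a unital complex *-algebra: a linear functional `φ` with `φ (a* a) ≥ 0` and
`φ 1 = 1`. -/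
structure StarAlgState (A : Type*) [Ring A] [StarRing A] [Algebra ℂ A] where
  /-- The underlying linear functional. -/
  toLinearMap : A →ₗ[ℂ] ℂ
  nonneg' : ∀ a : A, 0 ≤ toLinearMap (star a * a)
  map_one' : toLinearMap 1 = 1

namespace StarAlgState

variable {A : Type*} [Ring A] [StarRing A] [Algebra ℂ A]

instance : CoeFun (StarAlgState A) (fun _ => A → ℂ) := ⟨fun φ => φ.toLinearMap⟩

/-- The state `½ (φ + ψ)`. -/
def average (φ ψ : StarAlgState A) : StarAlgState A where
  toLinearMap := (1 / 2 : ℂ) • (φ.toLinearMap + ψ.toLinearMap)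
  nonneg' a := by
    have h : (0 : ℂ) ≤ 1 / 2 := by
      rw [Complex.le_def]; norm_num
    exact mul_nonneg h (add_nonneg (φ.nonneg' a) (ψ.nonneg' a))
  map_one' := by
    simp only [LinearMap.smul_apply, LinearMap.add_apply, φ.map_one', ψ.map_one']
    norm_num

variable [StarModule ℂ A]

theorem map_star (φ : StarAlgState A) (a : A) : φ (star a) = star (φ a) := by
  have im0 : ∀ b : A, (φ.toLinearMap (star b * b)).im = 0 := fun b =>
    ((Complex.le_def.mp (φ.nonneg' b)).2).symm
  have h1 := im0 (a + 1)
  have h2 := im0 (Complex.I • a + 1)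
  have ha := im0 a
  have key1 : star (a + 1) * (a + 1) = star a * a + star a + a + 1 := by
    simp only [star_add, star_one]; noncomm_ring
  have key2 : star (Complex.I • a + 1) * (Complex.I • a + 1)
      = star a * a - Complex.I • star a + Complex.I • a + 1 := by
    simp only [star_add, star_one, star_smul, add_mul, mul_add, mul_one, one_mul,
      smul_mul_smul_comm, Complex.star_def, Complex.conj_I]
    simp [sub_eq_add_neg]
    abel
  rw [key1] at h1
  rw [key2] at h2
  simp only [map_add, map_sub, map_smul, φ.map_one', smul_eq_mul, Complex.add_im, Complex.sub_im,
    Complex.mul_im, Complex.I_re, Complex.I_im, Complex.one_im, ha] at h1 h2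
  apply Complex.ext
  · simp only [Complex.star_def, Complex.conj_re]; linarith
  · simp only [Complex.star_def, Complex.conj_im]; linarith

/-- A copy of `A`, to carry the semi-inner product `⟨a, b⟩ = φ (a* b)`. -/
@[nolint unusedArguments]
def PreGNS (_φ : StarAlgState A) : Type _ := A

instance (φ : StarAlgState A) : AddCommGroup φ.PreGNS := inferInstanceAs (AddCommGroup A)
instance (φ : StarAlgState A) : Module ℂ φ.PreGNS := inferInstanceAs (Module ℂ A)

/-- The identity map from `A` to its copy. -/
def toPreGNS (φ : StarAlgState A) : A ≃ₗ[ℂ] φ.PreGNS := LinearEquiv.refl ℂ A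

/-- The semi-inner product `⟨a, b⟩ = φ (a* b)`. -/
abbrev preGNSCore (φ : StarAlgState A) : PreInnerProductSpace.Core ℂ φ.PreGNS where
  inner a b := φ (star (φ.toPreGNS.symm a) * φ.toPreGNS.symm b)
  conj_inner_symm a b := by
    rw [← Complex.star_def, ← φ.map_star]; simp
  re_inner_nonneg a := (Complex.le_def.mp (φ.nonneg' _)).1
  add_left a b c := by simp [add_mul]
  smul_left a b r := by simp

instance (φ : StarAlgState A) : SeminormedAddCommGroup φ.PreGNS :=
  InnerProductSpace.Core.toSeminormedAddCommGroup (c := φ.preGNSCore)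
instance (φ : StarAlgState A) : InnerProductSpace ℂ φ.PreGNS :=
  InnerProductSpace.ofCore φ.preGNSCore

theorem inner_toPreGNS (φ : StarAlgState A) (a b : A) :
    ⟪φ.toPreGNS a, φ.toPreGNS b⟫_ℂ = φ (star a * b) := rfl

/-- The GNS Hilbert space: the Hausdorff completion of `A` for `⟨a, b⟩ = φ (a* b)`, that is, the
completion of the quotient of `A` by the null space. -/
abbrev GNS (φ : StarAlgState A) : Type _ := Completion φ.PreGNS

/-- The algebra is the linear span of its unitary elements. This makes every GNS representation
one by bounded operators. -/
class _root_.SpannedByUnitaries (A : Type*) [Ring A] [StarRing A] [Algebra ℂ A] : Prop where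
  span_unitary : Submodule.span ℂ (unitary A : Set A) = ⊤

/-- Left multiplication by `a`, on the copy of `A`. -/
def leftMulLinear (φ : StarAlgState A) (a : A) : φ.PreGNS →ₗ[ℂ] φ.PreGNS :=
  φ.toPreGNS.toLinearMap ∘ₗ LinearMap.mulLeft ℂ a ∘ₗ φ.toPreGNS.symm.toLinearMap

theorem exists_bound_leftMul [SpannedByUnitaries A] (φ : StarAlgState A) (a : A) :
    ∃ C : ℝ, ∀ x : φ.PreGNS, ‖φ.leftMulLinear a x‖ ≤ C * ‖x‖ := by
  have ha : a ∈ Submodule.span ℂ (unitary A : Set A) := by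
    rw [SpannedByUnitaries.span_unitary]; trivial
  induction ha using Submodule.span_induction with
  | mem u hu =>
    refine ⟨1, fun x => le_of_eq ?_⟩
    rw [one_mul, norm_eq_sqrt_re_inner (𝕜 := ℂ), norm_eq_sqrt_re_inner (𝕜 := ℂ)]
    have h : ⟪φ.leftMulLinear u x, φ.leftMulLinear u x⟫_ℂ = ⟪x, x⟫_ℂ := by
      change φ (star (u * φ.toPreGNS.symm x) * (u * φ.toPreGNS.symm x))
        = φ (star (φ.toPreGNS.symm x) * φ.toPreGNS.symm x)
      rw [star_mul, mul_assoc, ← mul_assoc (star u), (Unitary.mem_iff.mp hu).1, one_mul]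
    rw [h]
  | zero => exact ⟨0, fun x => by simp [leftMulLinear]⟩
  | add a b _ _ iha ihb =>
    obtain ⟨C, hC⟩ := iha
    obtain ⟨D, hD⟩ := ihb
    refine ⟨C + D, fun x => ?_⟩
    have h : φ.leftMulLinear (a + b) x = φ.leftMulLinear a x + φ.leftMulLinear b x := by
      simp [leftMulLinear, add_mul]
    rw [h, add_mul]
    exact (norm_add_le _ _).trans (add_le_add (hC x) (hD x))
  | smul r a _ iha =>
    obtain ⟨C, hC⟩ := iha
    refine ⟨‖r‖ * C, fun x => ?_⟩
    have h : φ.leftMulLinear (r • a) x = r • φ.leftMulLinear a x := by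
      simp [leftMulLinear]
    rw [h, norm_smul, mul_assoc]
    exact mul_le_mul_of_nonneg_left (hC x) (norm_nonneg r)

/-- Left multiplication by `a`, as a bounded operator on the copy of `A`. -/
def leftMul [SpannedByUnitaries A] (φ : StarAlgState A) (a : A) : φ.PreGNS →L[ℂ] φ.PreGNS :=
  LinearMap.mkContinuousOfExistsBound (φ.leftMulLinear a) (φ.exists_bound_leftMul a)

theorem leftMul_toPreGNS [SpannedByUnitaries A] (φ : StarAlgState A) (a b : A) :
    φ.leftMul a (φ.toPreGNS b) = φ.toPreGNS (a * b) := rfl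

/-- The operator `π a` on the GNS space: the continuous extension of left multiplication by `a`. -/
def gnsOp [SpannedByUnitaries A] (φ : StarAlgState A) (a : A) : φ.GNS →L[ℂ] φ.GNS := (φ.leftMul a).completion

theorem gnsOp_coe [SpannedByUnitaries A] (φ : StarAlgState A) (a b : A) :
    φ.gnsOp a (φ.toPreGNS b : φ.GNS) = (φ.toPreGNS (a * b) : φ.GNS) := by
  change (φ.leftMul a).completion _ = _
  simp [leftMul_toPreGNS]

theorem gnsOp_ext (φ : StarAlgState A) {S T : φ.GNS →L[ℂ] φ.GNS}
    (h : ∀ b : A, S (φ.toPreGNS b : φ.GNS) = T (φ.toPreGNS b : φ.GNS)) : S = T := by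
  ext x
  induction x using Completion.induction_on with
  | hp => exact isClosed_eq S.continuous T.continuous
  | ih x => exact h (φ.toPreGNS.symm x)

/-- The GNS representation `π` of `A` on the GNS space. -/
def gnsRep [SpannedByUnitaries A] (φ : StarAlgState A) : A →⋆ₐ[ℂ] (φ.GNS →L[ℂ] φ.GNS) where
  toFun := φ.gnsOp
  map_one' := φ.gnsOp_ext fun b => by simp [gnsOp_coe]
  map_mul' a a' := φ.gnsOp_ext fun b => by simp [gnsOp_coe, mul_assoc]
  map_zero' := φ.gnsOp_ext fun b => by
    rw [gnsOp_coe, zero_mul, map_zero, Completion.coe_zero, zero_apply]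
  map_add' a a' := φ.gnsOp_ext fun b => by simp [gnsOp_coe, add_mul, Completion.coe_add]
  commutes' r := φ.gnsOp_ext fun b => by
    simp [gnsOp_coe, Algebra.algebraMap_eq_smul_one]
  map_star' a := by
    rw [ContinuousLinearMap.star_eq_adjoint, ContinuousLinearMap.eq_adjoint_iff]
    intro x y
    induction x, y using Completion.induction_on₂ with
    | hp => apply isClosed_eq <;> fun_prop
    | ih x y =>
      obtain ⟨x, rfl⟩ := φ.toPreGNS.surjective x
      obtain ⟨y, rfl⟩ := φ.toPreGNS.surjective y
      simp only [gnsOp_coe, Completion.inner_coe, inner_toPreGNS, star_mul, star_star, mul_assoc]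

/-- The GNS von Neumann algebra of `φ`: the von Neumann algebra `π(A)''` generated by the image of
the GNS representation. -/
def gnsVonNeumannAlgebra [SpannedByUnitaries A] (φ : StarAlgState A) : VonNeumannAlgebra φ.GNS where
  toStarSubalgebra := StarSubalgebra.centralizer ℂ
    (StarSubalgebra.centralizer ℂ (Set.range φ.gnsRep) : Set (φ.GNS →L[ℂ] φ.GNS))
  centralizer_centralizer' := by simp

theorem coe_gnsVonNeumannAlgebra [SpannedByUnitaries A] (φ : StarAlgState A) :
    (φ.gnsVonNeumannAlgebra : Set (φ.GNS →L[ℂ] φ.GNS))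
      = Set.centralizer (Set.centralizer (Set.range φ.gnsRep)) := by
  have h : star (Set.range φ.gnsRep) = Set.range φ.gnsRep := by
    ext x
    simp only [Set.mem_star, Set.mem_range]
    constructor
    · rintro ⟨a, ha⟩
      exact ⟨star a, by rw [StarHomClass.map_star, ha, star_star]⟩
    · rintro ⟨a, ha⟩
      exact ⟨star a, by rw [StarHomClass.map_star, ha]⟩
  have h' : (φ.gnsVonNeumannAlgebra : Set (φ.GNS →L[ℂ] φ.GNS))
      = (StarSubalgebra.centralizer ℂ (StarSubalgebra.centralizer ℂ (Set.range φ.gnsRep) :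
        Set (φ.GNS →L[ℂ] φ.GNS)) : StarSubalgebra ℂ (φ.GNS →L[ℂ] φ.GNS)) := rfl
  rw [h']
  simp [StarSubalgebra.coe_centralizer, h, Set.star_centralizer]

end StarAlgState

/-- A von Neumann algebra is a factor if its center consists of the scalars only. -/
def VonNeumannAlgebra.IsFactor {H : Type*} [NormedAddCommGroup H] [InnerProductSpace ℂ H]
    [CompleteSpace H] (M : VonNeumannAlgebra H) : Prop :=
  (M : Set (H →L[ℂ] H)) ∩ M.commutant = Set.range (algebraMap ℂ (H →L[ℂ] H))

end GNS

/-! ### Parafermion algebras -/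

namespace Parafermion

/-- The symbols `c j` and their formal adjoints `cstar j`. -/
inductive Gen (ι : Type*)
  | c (j : ι)
  | cstar (j : ι)

/-- `q = exp (2 π i / d)`. -/
def q (d : ℕ) : ℂ := Complex.exp (2 * Real.pi * Complex.I / d)

/-- The canonical parafermion relations. -/
inductive Rel (d : ℕ) (ι : Type*) [LinearOrder ι] :
    FreeAlgebra ℂ (Gen ι) → FreeAlgebra ℂ (Gen ι) → Prop
  | comm (j k : ι) (h : j < k) :
      Rel d ι (FreeAlgebra.ι ℂ (.c j) * FreeAlgebra.ι ℂ (.c k))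
        (q d • (FreeAlgebra.ι ℂ (.c k) * FreeAlgebra.ι ℂ (.c j)))
  | pow (j : ι) : Rel d ι (FreeAlgebra.ι ℂ (.c j) ^ d) 1
  | mul_star (j : ι) : Rel d ι (FreeAlgebra.ι ℂ (.c j) * FreeAlgebra.ι ℂ (.cstar j)) 1
  | star_mul (j : ι) : Rel d ι (FreeAlgebra.ι ℂ (.cstar j) * FreeAlgebra.ι ℂ (.c j)) 1

end Parafermion

/-- The parafermion algebra of degree `d`, generated by parafermions `c j` indexed by a linearly
ordered set `ι`, subject to `c j * c k = q • (c k * c j)` for `j < k`, `c j ^ d = 1` and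
`(c j)* = (c j)⁻¹`. -/
def PF (d : ℕ) (ι : Type*) [LinearOrder ι] : Type _ := RingQuot (Parafermion.Rel d ι)

namespace PF

open Parafermion

variable {d : ℕ} {ι κ : Type*} [LinearOrder ι] [LinearOrder κ]

instance : Ring (PF d ι) := inferInstanceAs (Ring (RingQuot (Rel d ι)))
instance : Algebra ℂ (PF d ι) := inferInstanceAs (Algebra ℂ (RingQuot (Rel d ι)))

/-- The quotient map. -/
def mk (d : ℕ) (ι : Type*) [LinearOrder ι] : FreeAlgebra ℂ (Gen ι) →ₐ[ℂ] PF d ι :=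
  RingQuot.mkAlgHom ℂ (Rel d ι)

theorem mk_surjective : Function.Surjective (mk d ι) := RingQuot.mkAlgHom_surjective ℂ _

/-- The parafermion `c j`. -/
def c (d : ℕ) {ι : Type*} [LinearOrder ι] (j : ι) : PF d ι := mk d ι (FreeAlgebra.ι ℂ (.c j))

/-- The adjoint of the parafermion `c j`. -/
def cstar (d : ℕ) {ι : Type*} [LinearOrder ι] (j : ι) : PF d ι :=
  mk d ι (FreeAlgebra.ι ℂ (.cstar j))

theorem mk_rel {x y : FreeAlgebra ℂ (Gen ι)} (h : Rel d ι x y) : mk d ι x = mk d ι y :=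
  RingQuot.mkAlgHom_rel ℂ h

theorem c_mul_c {j k : ι} (h : j < k) : c d j * c d k = q d • (c d k * c d j) := by
  simpa [c] using mk_rel (Rel.comm (d := d) j k h)

theorem c_pow (j : ι) : c d j ^ d = 1 := by
  simpa [c] using mk_rel (Rel.pow (d := d) j)

theorem c_mul_cstar (j : ι) : c d j * cstar d j = 1 := by
  simpa [c, cstar] using mk_rel (Rel.mul_star (d := d) j)

theorem cstar_mul_c (j : ι) : cstar d j * c d j = 1 := by
  simpa [c, cstar] using mk_rel (Rel.star_mul (d := d) j)

@[elab_as_elim]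
theorem induction {p : PF d ι → Prop} (hs : ∀ r : ℂ, p (algebraMap ℂ _ r))
    (hc : ∀ j, p (c d j)) (hc' : ∀ j, p (cstar d j)) (ha : ∀ x y, p x → p y → p (x + y))
    (hm : ∀ x y, p x → p y → p (x * y)) (x : PF d ι) : p x := by
  obtain ⟨x, rfl⟩ := mk_surjective x
  induction x using FreeAlgebra.induction with
  | grade0 r => rw [AlgHom.commutes]; exact hs r
  | grade1 g =>
    cases g with
    | c j => exact hc j
    | cstar j => exact hc' j
  | mul x y hx hy => rw [map_mul]; exact hm _ _ hx hy
  | add x y hx hy => rw [map_add]; exact ha _ _ hx hy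

theorem q_mul_conj (d : ℕ) : q d * star (q d) = 1 := by
  rw [q, Complex.star_def, ← Complex.exp_conj, ← Complex.exp_add]
  simp [Complex.conj_ofNat, ← add_div]

/-- The opposite algebra with conjugated scalars. -/
abbrev conjOpAlgebra (B : Type*) [Ring B] [Algebra ℂ B] : Algebra ℂ Bᵐᵒᵖ :=
  RingHom.toAlgebra' ((algebraMap ℂ Bᵐᵒᵖ).comp (starRingEnd ℂ))
    (fun r x => Algebra.commutes (R := ℂ) (A := Bᵐᵒᵖ) (starRingEnd ℂ r) x)

/-- The adjoints of the generators. -/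
def genStar (d : ℕ) {ι : Type*} [LinearOrder ι] : Gen ι → (PF d ι)ᵐᵒᵖ
  | .c j => MulOpposite.op (cstar d j)
  | .cstar j => MulOpposite.op (c d j)

/-- The conjugate linear antihomomorphism from the free algebra that exchanges `c j` and
`cstar j`. -/
def freeStar (d : ℕ) (ι : Type*) [LinearOrder ι] : FreeAlgebra ℂ (Gen ι) →+* (PF d ι)ᵐᵒᵖ :=
  letI : Algebra ℂ (PF d ι)ᵐᵒᵖ := conjOpAlgebra (PF d ι)
  (FreeAlgebra.lift ℂ (genStar d) : FreeAlgebra ℂ (Gen ι) →ₐ[ℂ] (PF d ι)ᵐᵒᵖ).toRingHom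

theorem freeStar_ι (g : Gen ι) : freeStar d ι (FreeAlgebra.ι ℂ g) = genStar d g := by
  let _i : Algebra ℂ (PF d ι)ᵐᵒᵖ := conjOpAlgebra (PF d ι)
  exact FreeAlgebra.lift_ι_apply (R := ℂ) (genStar d) g

theorem freeStar_algebraMap (r : ℂ) : freeStar d ι (algebraMap ℂ _ r)
    = MulOpposite.op (algebraMap ℂ (PF d ι) (star r)) := by
  let _i : Algebra ℂ (PF d ι)ᵐᵒᵖ := conjOpAlgebra (PF d ι)
  exact (FreeAlgebra.lift ℂ (genStar d) : FreeAlgebra ℂ (Gen ι) →ₐ[ℂ] (PF d ι)ᵐᵒᵖ).commutes r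

theorem cstar_mul_cstar {j k : ι} (h : j < k) :
    cstar d k * cstar d j = star (q d) • (cstar d j * cstar d k) := by
  have h1 := congrArg (fun x => star (q d) • (cstar d k * cstar d j * x * (cstar d j * cstar d k)))
    (c_mul_c (d := d) h)
  have e1 : cstar d k * cstar d j * (c d j * c d k) = 1 := by
    rw [mul_assoc, ← mul_assoc (cstar d j), cstar_mul_c, one_mul, cstar_mul_c]
  have e2 : c d k * c d j * (cstar d j * cstar d k) = 1 := by
    rw [mul_assoc, ← mul_assoc (c d j), c_mul_cstar, one_mul, c_mul_cstar]
  simp only [mul_smul_comm, smul_mul_assoc, e1, one_mul, smul_smul] at h1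
  rw [mul_assoc (cstar d k * cstar d j), e2, mul_one, mul_comm, q_mul_conj, one_smul] at h1
  exact h1.symm

theorem cstar_pow (j : ι) : cstar d j ^ d = 1 := by
  have hcomm : Commute (c d j) (cstar d j) := by
    rw [Commute, SemiconjBy, c_mul_cstar, cstar_mul_c]
  have h := hcomm.mul_pow d
  rwa [c_mul_cstar, one_pow, c_pow, one_mul, eq_comm] at h

theorem freeStar_rel {x y : FreeAlgebra ℂ (Gen ι)} (h : Rel d ι x y) :
    freeStar d ι x = freeStar d ι y := by
  cases h with
  | comm j k h =>
    rw [Algebra.smul_def]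
    simp only [map_mul, freeStar_ι, freeStar_algebraMap, genStar, ← MulOpposite.op_mul]
    rw [cstar_mul_cstar h, Algebra.smul_def, Algebra.commutes]
  | pow j =>
    simp only [map_pow, map_one, freeStar_ι, genStar, ← MulOpposite.op_pow, cstar_pow,
      MulOpposite.op_one]
  | mul_star j =>
    simp only [map_mul, map_one, freeStar_ι, genStar, ← MulOpposite.op_mul, c_mul_cstar,
      MulOpposite.op_one]
  | star_mul j =>
    simp only [map_mul, map_one, freeStar_ι, genStar, ← MulOpposite.op_mul, cstar_mul_c,
      MulOpposite.op_one]

/-- The adjoint operation, as a ring homomorphism to the opposite ring. -/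
def starHom (d : ℕ) (ι : Type*) [LinearOrder ι] : PF d ι →+* (PF d ι)ᵐᵒᵖ :=
  RingQuot.lift ⟨freeStar d ι, fun _ _ h => freeStar_rel h⟩

theorem starHom_mk (x : FreeAlgebra ℂ (Gen ι)) : starHom d ι (mk d ι x) = freeStar d ι x := by
  change RingQuot.lift _ (RingQuot.mkAlgHom ℂ (Rel d ι) x) = _
  have h : RingQuot.mkAlgHom ℂ (Rel d ι) x = RingQuot.mkRingHom (Rel d ι) x :=
    congrArg (fun f => f x) (RingQuot.mkAlgHom_coe ℂ (Rel d ι))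
  rw [h]
  exact RingQuot.lift_mkRingHom_apply _ _ _

theorem starHom_c (j : ι) : starHom d ι (c d j) = MulOpposite.op (cstar d j) := by
  rw [c, starHom_mk, freeStar_ι, genStar]

theorem starHom_cstar (j : ι) : starHom d ι (cstar d j) = MulOpposite.op (c d j) := by
  rw [cstar, starHom_mk, freeStar_ι, genStar]

theorem starHom_algebraMap (r : ℂ) : starHom d ι (algebraMap ℂ _ r)
    = MulOpposite.op (algebraMap ℂ (PF d ι) (star r)) := by
  rw [← (mk d ι).commutes, starHom_mk, freeStar_algebraMap]

/-- The *-structure: the conjugate linear antiautomorphism with `(c j)* = (c j)⁻¹`. -/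
instance : StarRing (PF d ι) where
  star x := (starHom d ι x).unop
  star_involutive x := by
    induction x using PF.induction with
    | hs r => simp [starHom_algebraMap]
    | hc j => simp [starHom_c, starHom_cstar]
    | hc' j => simp [starHom_c, starHom_cstar]
    | ha x y hx hy => simp [hx, hy]
    | hm x y hx hy => simp [hx, hy]
  star_mul x y := by simp
  star_add x y := by simp

theorem star_c (j : ι) : star (c d j) = cstar d j := by
  change (starHom d ι (c d j)).unop = _
  rw [starHom_c]; rfl

theorem star_cstar (j : ι) : star (cstar d j) = c d j := by
  rw [← star_c, star_star]

instance : StarModule ℂ (PF d ι) where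
  star_smul r x := by
    have h : star (algebraMap ℂ (PF d ι) r) = algebraMap ℂ _ (star r) := by
      change (starHom d ι _).unop = _
      rw [starHom_algebraMap]; rfl
    rw [Algebra.smul_def, star_mul, h, Algebra.smul_def, Algebra.commutes]

theorem c_mem_unitary (j : ι) : c d j ∈ unitary (PF d ι) := by
  rw [Unitary.mem_iff, star_c]
  exact ⟨cstar_mul_c j, c_mul_cstar j⟩

instance : SpannedByUnitaries (PF d ι) where
  span_unitary := by
    have hmul : ∀ x ∈ Submodule.span ℂ (unitary (PF d ι) : Set (PF d ι)),
        ∀ y ∈ Submodule.span ℂ (unitary (PF d ι) : Set (PF d ι)),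
        x * y ∈ Submodule.span ℂ (unitary (PF d ι) : Set (PF d ι)) := by
      intro x hx y hy
      have h := Submodule.mul_mem_mul hx hy
      rw [Submodule.span_mul_span] at h
      refine Submodule.span_mono ?_ h
      rintro _ ⟨u, hu, v, hv, rfl⟩
      exact mul_mem hu hv
    rw [eq_top_iff]
    intro x _
    induction x using PF.induction with
    | hs r =>
      rw [Algebra.algebraMap_eq_smul_one]
      exact Submodule.smul_mem _ _ (Submodule.subset_span (one_mem (unitary (PF d ι))))
    | hc j => exact Submodule.subset_span (c_mem_unitary j)
    | hc' j =>
      rw [← star_c]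
      exact Submodule.subset_span (Unitary.star_mem (c_mem_unitary j))
    | ha x y hx hy => exact Submodule.add_mem _ (hx trivial) (hy trivial)
    | hm x y hx hy => exact hmul x (hx trivial) y (hy trivial)

/-- The elements of degree (charge) `k`: the span of the monomials in the parafermions whose
number of factors is `k` modulo `d`. -/
def chargeSubspace (d : ℕ) (ι : Type*) [LinearOrder ι] (k : ZMod d) : Submodule ℂ (PF d ι) :=
  Submodule.span ℂ {x | ∃ l : List ι, (l.length : ZMod d) = k ∧ x = (l.map (c d)).prod}

/-- A state is neutral if it vanishes on all elements of nonzero charge. -/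
def IsNeutral (φ : StarAlgState (PF d ι)) : Prop :=
  ∀ k : ZMod d, k ≠ 0 → ∀ x ∈ chargeSubspace d ι k, φ x = 0

/-- The homomorphism `c j ↦ c (f j)` for an order embedding `f` of the index sets. -/
def map (d : ℕ) (f : ι ↪o κ) : PF d ι →ₐ[ℂ] PF d κ :=
  RingQuot.liftAlgHom ℂ ⟨FreeAlgebra.lift ℂ fun g => match g with
    | .c j => c d (f j)
    | .cstar j => cstar d (f j), by
      intro x y h
      cases h with
      | comm j k h => simpa using c_mul_c (f.lt_iff_lt.mpr h)
      | pow j => simpa using c_pow (f j)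
      | mul_star j => simpa using c_mul_cstar (f j)
      | star_mul j => simpa using cstar_mul_c (f j)⟩

theorem map_c (f : ι ↪o κ) (j : ι) : map d f (c d j) = c d (f j) := by
  change RingQuot.liftAlgHom ℂ _ (RingQuot.mkAlgHom ℂ (Rel d ι) _) = _
  rw [RingQuot.liftAlgHom_mkAlgHom_apply, FreeAlgebra.lift_ι_apply]

/-- The positions `2 k`, `2 k + 1` of the `k`-th pair of parafermions (counted from `0`). -/
def pairEmb (k : ℕ) : Fin 2 ↪o ℕ :=
  OrderEmbedding.ofStrictMono (fun j => 2 * k + (j : ℕ)) fun i j h => by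
    have : (i : ℕ) < j := h
    simpa using this

/-- The inclusion of `PF_2` into `PF_∞` as the algebra of the `k`-th pair of parafermions. -/
def site (d k : ℕ) : PF d (Fin 2) →ₐ[ℂ] PF d ℕ := map d (pairEmb k)

/-- `φ` is the infinite product `∏ ρ` of the state `ρ` on `PF_2`: on a product of elements of
successive pairs, in increasing order of the pairs, its value is the product of the values
of `ρ`. -/
def IsInfiniteProduct (ρ : StarAlgState (PF d (Fin 2))) (φ : StarAlgState (PF d ℕ)) : Prop :=
  ∀ (n : ℕ) (x : Fin n → PF d (Fin 2)),
    φ (List.ofFn fun k : Fin n => site d k (x k)).prod = ∏ k, ρ (x k)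

end PF

end

/-! Existence and uniqueness. By the commutation relations the ordered monomials span `PF d ℕ`, so
the product rule determines the functional. Conversely, a representation on a space with one basis
vector per ordered monomial lets values be prescribed freely on the monomials (`regular_monomial`),
which gives a product functional. Positivity is where neutrality matters: moving one pair past a
monomial of earlier pairs costs a phase depending on the charges, but the functional vanishes on
every monomial for which this phase could differ from `1`. Hence the Gram matrix of the monomials is
an entrywise product of Gram matrices of `ρ`, positive by the Schur product theorem
(`IsMonomialProduct.nonneg`).

Non-factoriality. Neutral states that differ do so on a monomial `x` of charge zero. Its copies
`site d k x` are unitary and eventually commute with any fixed element, so in the GNS representation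
of the average they converge weakly to an operator `Z` with `⟨a, Z b⟩ = ½ (ρ x * Φ (a* b) + τ x * T
(a* b))`. This `Z` is central. Were it a scalar `z`, evaluating the functional at `1` and at `site d
0 x` would give `(ρ x + τ x) / 2 = z` and `(ρ x ^ 2 + τ x ^ 2) / 2 = z * (ρ x + τ x) / 2`, whence
`(ρ x - τ x) ^ 2 = 0`. -/

noncomputable section

set_option linter.unusedSectionVars false

/-! ### Ordered monomials in the parafermions -/

namespace PF

open Parafermion

section Monomials

variable {d : ℕ} {ι : Type*} [LinearOrder ι]

/-- The power of a parafermion with exponent in `ZMod d`. -/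
def cpow (j : ι) (s : ZMod d) : PF d ι := c d j ^ s.val

theorem cpow_natCast (j : ι) (n : ℕ) : cpow j (n : ZMod d) = c d j ^ n := by
  rw [cpow, ZMod.val_natCast, ← pow_eq_pow_mod n (c_pow j)]

@[simp] theorem cpow_zero (j : ι) : cpow j (0 : ZMod d) = 1 := by simp [cpow]

theorem cpow_mem_unitary (j : ι) (s : ZMod d) : cpow j s ∈ unitary (PF d ι) :=
  pow_mem (c_mem_unitary j) s.val

theorem map_cpow {κ : Type*} [LinearOrder κ] (f : ι ↪o κ) (j : ι) (s : ZMod d) :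
    map d f (cpow j s) = cpow (f j) s := by
  rw [cpow, map_pow, map_c, cpow]

/-- The ordered monomial `c 0 ^ a 0 * ⋯ * c (N - 1) ^ a (N - 1)`. -/
def monomial (a : ℕ → ZMod d) : ℕ → PF d ℕ
  | 0 => 1
  | N + 1 => monomial a N * cpow N (a N)

@[simp] theorem monomial_zero (a : ℕ → ZMod d) : monomial a 0 = 1 := rfl

theorem monomial_succ (a : ℕ → ZMod d) (N : ℕ) :
    monomial a (N + 1) = monomial a N * cpow N (a N) := rfl

theorem cpow_one (j : ι) : cpow j (1 : ZMod d) = c d j := by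
  simpa using cpow_natCast (d := d) j 1

theorem monomial_congr {a b : ℕ → ZMod d} {N : ℕ} (h : ∀ i < N, a i = b i) :
    monomial a N = monomial b N := by
  induction N with
  | zero => rfl
  | succ N ih => rw [monomial_succ, monomial_succ, ih fun i hi => h i (by omega), h N (by omega)]

theorem monomial_of_le {a : ℕ → ZMod d} {M N : ℕ} (hMN : M ≤ N) (h : ∀ i, M ≤ i → a i = 0) :
    monomial a N = monomial a M := by
  induction N, hMN using Nat.le_induction with
  | base => rfl
  | succ N hN ih => rw [monomial_succ, h N hN, cpow_zero, mul_one, ih]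

/-- The ordered monomial `c 0 ^ s * c 1 ^ t` of a pair of parafermions. -/
def pairMonomial (s t : ZMod d) : PF d (Fin 2) := cpow 0 s * cpow 1 t

theorem site_pairMonomial (k : ℕ) (s t : ZMod d) :
    site d k (pairMonomial s t) = cpow (2 * k) s * cpow (2 * k + 1) t := by
  rw [pairMonomial, map_mul, site, map_cpow, map_cpow]
  rfl

theorem monomial_two_mul_succ (a : ℕ → ZMod d) (n : ℕ) :
    monomial a (2 * (n + 1))
      = monomial a (2 * n) * site d n (pairMonomial (a (2 * n)) (a (2 * n + 1))) := by
  rw [site_pairMonomial, ← mul_assoc]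
  rfl

/-! ### Commutation phases and spanning by ordered monomials -/

variable [NeZero d]

/-- The additive character `k ↦ q ^ k` of `ZMod d`. -/
def phase (d : ℕ) [NeZero d] : AddChar (ZMod d) ℂ := ZMod.stdAddChar

theorem phase_one : phase d 1 = q d := by
  have h := ZMod.stdAddChar_coe (N := d) 1
  rw [phase, q]
  simpa using h

theorem phase_neg_mul_phase (s : ZMod d) : phase d (-s) * phase d s = 1 := by
  rw [← AddChar.map_add_eq_mul, neg_add_cancel, AddChar.map_zero_eq_one]

theorem cpow_add (j : ι) (s t : ZMod d) : cpow j (s + t) = cpow j s * cpow j t := by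
  obtain ⟨m, rfl⟩ := ZMod.natCast_zmod_surjective s
  obtain ⟨n, rfl⟩ := ZMod.natCast_zmod_surjective t
  rw [← Nat.cast_add, cpow_natCast, cpow_natCast, cpow_natCast, pow_add]

theorem star_cpow (j : ι) (s : ZMod d) : star (cpow j s) = cpow j (-s) := by
  have h1 : cpow j (-s) * cpow j s = 1 := by rw [← cpow_add, neg_add_cancel, cpow_zero]
  have h2 : cpow j s * star (cpow j s) = 1 :=
    (Unitary.mem_iff.mp (pow_mem (c_mem_unitary j) s.val)).2
  exact (left_inv_eq_right_inv h1 h2).symm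

theorem cstar_eq_cpow (j : ι) : cstar d j = cpow j (-1 : ZMod d) := by
  rw [← star_c, ← cpow_one, star_cpow]

theorem cpow_mul_cpow {j k : ι} (h : j < k) (s t : ZMod d) :
    cpow j s * cpow k t = phase d (s * t) • (cpow k t * cpow j s) := by
  have h1 : ∀ n : ℕ, c d j * c d k ^ n = phase d n • (c d k ^ n * c d j) := by
    intro n
    induction n with
    | zero => simp [AddChar.map_zero_eq_one]
    | succ n ih =>
      rw [pow_succ, ← mul_assoc, ih, smul_mul_assoc, mul_assoc, c_mul_c h, mul_smul_comm, smul_smul,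
        ← phase_one, ← AddChar.map_add_eq_mul, ← mul_assoc, Nat.cast_succ]
  have h2 : ∀ m n : ℕ, c d j ^ m * c d k ^ n = phase d (m * n) • (c d k ^ n * c d j ^ m) := by
    intro m n
    induction m with
    | zero => simp [AddChar.map_zero_eq_one]
    | succ m ih =>
      rw [pow_succ, mul_assoc, h1, mul_smul_comm, ← mul_assoc, ih, smul_mul_assoc, smul_smul,
        ← AddChar.map_add_eq_mul, mul_assoc, Nat.cast_succ]
      congr 2
      ring
  obtain ⟨m, rfl⟩ := ZMod.natCast_zmod_surjective s
  obtain ⟨n, rfl⟩ := ZMod.natCast_zmod_surjective t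
  rw [cpow_natCast, cpow_natCast, h2]

theorem cpow_mul_cpow' {j k : ι} (h : j < k) (s t : ZMod d) :
    cpow k t * cpow j s = phase d (-(t * s)) • (cpow j s * cpow k t) := by
  rw [cpow_mul_cpow h, smul_smul, mul_comm s t, phase_neg_mul_phase, one_smul]

/-- Each factor passed contributes its own phase, so the total depends only on the charge of the
monomial. All later phase computations rest on this. -/
theorem cpow_mul_monomial (a : ℕ → ZMod d) {N j : ℕ} (h : N ≤ j) (s : ZMod d) :
    cpow j s * monomial a N
      = phase d (-(s * ∑ i ∈ Finset.range N, a i)) • (monomial a N * cpow j s) := by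
  induction N with
  | zero => simp [AddChar.map_zero_eq_one]
  | succ N ih =>
    rw [monomial_succ, ← mul_assoc, ih (by omega), smul_mul_assoc, mul_assoc (monomial a N),
      cpow_mul_cpow' (show N < j by omega), mul_smul_comm, smul_smul, ← AddChar.map_add_eq_mul,
      Finset.sum_range_succ, ← mul_assoc]
    congr 2
    ring

theorem exists_cpow_mul_monomial (a : ℕ → ZMod d) {N j : ℕ} (h : j < N) (s : ZMod d) :
    ∃ z : ℂ, cpow j s * monomial a N = z • monomial (a + Pi.single j s) N := by
  induction N, h using Nat.le_induction with
  | base =>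
    refine ⟨phase d (-(s * ∑ i ∈ Finset.range j, a i)), ?_⟩
    rw [Nat.succ_eq_add_one, monomial_succ, ← mul_assoc, cpow_mul_monomial a le_rfl, smul_mul_assoc,
      mul_assoc, ← cpow_add, monomial_succ,
      monomial_congr (a := a) (b := a + Pi.single j s) (N := j) fun i hi => by simp [hi.ne]]
    simp [add_comm]
  | succ N hN ih =>
    obtain ⟨z, hz⟩ := ih
    refine ⟨z, ?_⟩
    rw [monomial_succ, ← mul_assoc, hz, smul_mul_assoc, monomial_succ]
    have : N ≠ j := by omega
    simp [this]

/-- The scalar `z` never has to be known: what matters later is only the charge of the product. -/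
theorem exists_star_monomial_mul (a b : ℕ → ZMod d) (N : ℕ) :
    ∃ z : ℂ, star (monomial a N) * monomial b N = z • monomial (b - a) N := by
  induction N with
  | zero => exact ⟨1, by simp⟩
  | succ N ih =>
    obtain ⟨z, hz⟩ := ih
    refine ⟨z * phase d (-(-a N * ∑ i ∈ Finset.range N, (b - a) i)), ?_⟩
    rw [monomial_succ, monomial_succ, star_mul, star_cpow, mul_assoc, ← mul_assoc (star _), hz,
      smul_mul_assoc, mul_smul_comm, ← mul_assoc, cpow_mul_monomial _ le_rfl, smul_mul_assoc,
      mul_assoc, ← cpow_add, smul_smul, monomial_succ, Pi.sub_apply, neg_add_eq_sub]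

theorem pairMonomial_mem_chargeSubspace (s t : ZMod d) :
    pairMonomial s t ∈ chargeSubspace d (Fin 2) (s + t) := by
  refine Submodule.subset_span
    ⟨List.replicate s.val 0 ++ List.replicate t.val 1, by simp, ?_⟩
  simp [pairMonomial, cpow]

theorem IsNeutral.apply_pairMonomial {ρ : StarAlgState (PF d (Fin 2))} (hρ : IsNeutral ρ)
    {s t : ZMod d} (h : s + t ≠ 0) : ρ (pairMonomial s t) = 0 :=
  hρ _ h _ (pairMonomial_mem_chargeSubspace s t)

/-- The powers `cpow j s` include both `c d j` and its adjoint, so such a `p` is a left ideal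
containing `1`. -/
theorem eq_top_of_mul_mem {p : Submodule ℂ (PF d ι)} (h1 : 1 ∈ p)
    (h : ∀ j s, ∀ y ∈ p, cpow j s * y ∈ p) : p = ⊤ := by
  have key : ∀ x : PF d ι, ∀ y ∈ p, x * y ∈ p := by
    intro x
    induction x using PF.induction with
    | hs r => intro y hy; rw [← Algebra.smul_def]; exact p.smul_mem r hy
    | hc j => intro y hy; rw [← cpow_one]; exact h j 1 y hy
    | hc' j => intro y hy; rw [cstar_eq_cpow]; exact h j (-1) y hy
    | ha x y hx hy => intro z hz; rw [add_mul]; exact p.add_mem (hx z hz) (hy z hz)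
    | hm x y hx hy => intro z hz; rw [mul_assoc]; exact hx _ (hy z hz)
  exact eq_top_iff.mpr fun x _ => by simpa using key x 1 h1

theorem span_pairMonomial :
    Submodule.span ℂ (Set.range fun p : ZMod d × ZMod d => pairMonomial p.1 p.2) = ⊤ := by
  refine eq_top_of_mul_mem (Submodule.subset_span ⟨((0 : ZMod d), (0 : ZMod d)), by simp [pairMonomial]⟩) ?_
  intro j s y hy
  induction hy using Submodule.span_induction with
  | mem y hy =>
    obtain ⟨⟨t, u⟩, rfl⟩ := hy
    match j with
    | 0 =>
      refine Submodule.subset_span ⟨(s + t, u), ?_⟩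
      simp [pairMonomial, cpow_add, mul_assoc]
    | 1 =>
      have : cpow 1 s * pairMonomial t u = phase d (-(s * t)) • pairMonomial t (s + u) := by
        rw [pairMonomial, ← mul_assoc, cpow_mul_cpow' (show (0 : Fin 2) < 1 by decide),
          smul_mul_assoc, mul_assoc, ← cpow_add, pairMonomial]
      rw [this]
      exact Submodule.smul_mem _ _ (Submodule.subset_span ⟨(t, s + u), rfl⟩)
  | zero => simp
  | add x y _ _ hx hy => rw [mul_add]; exact Submodule.add_mem _ hx hy
  | smul r x _ hx => rw [mul_smul_comm]; exact Submodule.smul_mem _ _ hx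

/-- The span of the ordered monomials in the first `n` pairs of parafermions. -/
def firstPairs (d : ℕ) [NeZero d] (n : ℕ) : Submodule ℂ (PF d ℕ) :=
  Submodule.span ℂ (Set.range fun a : ℕ → ZMod d => monomial a (2 * n))

theorem monomial_mem_firstPairs (a : ℕ → ZMod d) (n : ℕ) :
    monomial a (2 * n) ∈ firstPairs d n := Submodule.subset_span ⟨a, rfl⟩

theorem firstPairs_mono : Monotone (firstPairs d) := by
  intro m n hmn
  refine Submodule.span_le.mpr ?_
  rintro _ ⟨a, rfl⟩
  have h : monomial a (2 * m) = monomial (fun i => if i < 2 * m then a i else 0) (2 * n) := by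
    rw [monomial_of_le (M := 2 * m) (by omega) fun i hi => if_neg (by omega)]
    exact monomial_congr fun i hi => (if_pos hi).symm
  simp only [h]
  exact monomial_mem_firstPairs _ n

theorem cpow_mul_mem_firstPairs {n j : ℕ} (h : j < 2 * n) (s : ZMod d) {y : PF d ℕ}
    (hy : y ∈ firstPairs d n) : cpow j s * y ∈ firstPairs d n := by
  induction hy using Submodule.span_induction with
  | mem y hy =>
    obtain ⟨a, rfl⟩ := hy
    obtain ⟨z, hz⟩ := exists_cpow_mul_monomial a h s
    simp only [hz]
    exact Submodule.smul_mem _ _ (monomial_mem_firstPairs _ n)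
  | zero => simp
  | add x y _ _ hx hy => rw [mul_add]; exact Submodule.add_mem _ hx hy
  | smul r x _ hx => rw [mul_smul_comm]; exact Submodule.smul_mem _ _ hx

theorem exists_mem_firstPairs (x : PF d ℕ) : ∃ n, x ∈ firstPairs d n := by
  have h : (⨆ n, firstPairs d n) = (⊤ : Submodule ℂ (PF d ℕ)) := by
    refine eq_top_of_mul_mem
      (Submodule.mem_iSup_of_mem 0 (monomial_mem_firstPairs (0 : ℕ → ZMod d) 0)) ?_
    intro j s y hy
    obtain ⟨n, hn⟩ := (Submodule.mem_iSup_of_directed _ firstPairs_mono.directed_le).mp hy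
    refine Submodule.mem_iSup_of_mem (max n (j + 1)) (cpow_mul_mem_firstPairs (by omega) s ?_)
    exact firstPairs_mono (le_max_left _ _) hn
  exact (Submodule.mem_iSup_of_directed _ firstPairs_mono.directed_le).mp
    (h ▸ Submodule.mem_top)

theorem mul_site_mem_firstPairs {n : ℕ} {y : PF d ℕ} (hy : y ∈ firstPairs d n)
    (x : PF d (Fin 2)) : y * site d n x ∈ firstPairs d (n + 1) := by
  have hx : x ∈ Submodule.span ℂ (Set.range fun p : ZMod d × ZMod d => pairMonomial p.1 p.2) :=
    span_pairMonomial (d := d) ▸ Submodule.mem_top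
  induction hx using Submodule.span_induction with
  | mem x hx =>
    obtain ⟨⟨s, t⟩, rfl⟩ := hx
    revert y
    suffices h : firstPairs d n ≤ (firstPairs d (n + 1)).comap
        (LinearMap.mulRight ℂ (site d n (pairMonomial s t))) from fun y hy => h hy
    refine Submodule.span_le.mpr ?_
    rintro _ ⟨a, rfl⟩
    refine Submodule.subset_span
      -- The exponents of `a` from `2 * n` on do not occur in `monomial a (2 * n)`, so they may be
      -- overwritten.
      ⟨fun i => if i = 2 * n then s else if i = 2 * n + 1 then t else a i, ?_⟩
    simp only [monomial_two_mul_succ]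
    rw [monomial_congr (d := d) (b := a) fun i hi => by
      rw [if_neg (by omega), if_neg (by omega)]]
    simp
  | zero => simp
  | add x y _ _ hx hy => rw [map_add, mul_add]; exact Submodule.add_mem _ hx hy
  | smul r x _ hx => rw [map_smul, mul_smul_comm]; exact Submodule.smul_mem _ _ hx

/-- Against a monomial of charge `e` the two factors pick up the phases of `-(s * e)` and `-(t *
e)`, which cancel because the pair has charge zero. -/
theorem commute_site_pairMonomial {s t : ZMod d} (hst : s + t = 0) {n k : ℕ} (h : n ≤ k)
    {y : PF d ℕ} (hy : y ∈ firstPairs d n) : Commute (site d k (pairMonomial s t)) y := by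
  induction hy using Submodule.span_induction with
  | mem y hy =>
    obtain ⟨a, rfl⟩ := hy
    rw [Commute, SemiconjBy, site_pairMonomial, mul_assoc, cpow_mul_monomial a (by omega),
      mul_smul_comm, ← mul_assoc, cpow_mul_monomial a (by omega), smul_mul_assoc, smul_smul,
      ← AddChar.map_add_eq_mul, mul_assoc, ← neg_add, ← add_mul, add_comm t, hst, zero_mul,
      neg_zero, AddChar.map_zero_eq_one, one_smul]
  | zero => exact Commute.zero_right _
  | add x y _ _ hx hy => exact hx.add_right hy
  | smul r x _ hx => exact hx.smul_right r

end Monomials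

end PF

/-! ### The regular representation and product functionals -/

namespace PF

open Parafermion

section Regular

variable {d : ℕ} [NeZero d]

/-- The operator by which `c j ^ s` acts on the vector space with a basis vector for each ordered
monomial. -/
def shift (j : ℕ) (s : ZMod d) : Module.End ℂ ((ℕ →₀ ZMod d) →₀ ℂ) :=
  Finsupp.lsum ℂ fun a =>
    -- The phase of moving `c j ^ s` to the right past the factors with index below `j`, as in
    -- `cpow_mul_monomial`.
    phase d (-(s * ∑ i ∈ Finset.range j, a i)) • Finsupp.lsingle (a + Finsupp.single j s)

theorem shift_single (j : ℕ) (s : ZMod d) (a : ℕ →₀ ZMod d) (z : ℂ) :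
    shift j s (Finsupp.single a z) = Finsupp.single (a + Finsupp.single j s)
      (phase d (-(s * ∑ i ∈ Finset.range j, a i)) * z) := by
  simp [shift]

theorem sum_range_add_single (a : ℕ →₀ ZMod d) (j k : ℕ) (s : ZMod d) :
    ∑ i ∈ Finset.range k, (a + Finsupp.single j s : ℕ →₀ ZMod d) i
      = ∑ i ∈ Finset.range k, a i + if j < k then s else 0 := by
  simp [Finset.sum_add_distrib, Finsupp.single_apply]

theorem shift_mul_shift (j : ℕ) (s t : ZMod d) : shift j s * shift j t = shift j (s + t) := by
  refine Finsupp.lhom_ext fun a z => ?_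
  rw [Module.End.mul_apply, shift_single, shift_single, shift_single, sum_range_add_single,
    if_neg (lt_irrefl j), add_zero, ← mul_assoc, ← AddChar.map_add_eq_mul, add_assoc,
    ← Finsupp.single_add, add_comm t]
  congr 3
  ring

theorem shift_zero (j : ℕ) : shift j (0 : ZMod d) = 1 := by
  refine Finsupp.lhom_ext fun a z => ?_
  simp [shift_single, AddChar.map_zero_eq_one]

theorem shift_pow (j : ℕ) (s : ZMod d) (n : ℕ) : shift j s ^ n = shift j ((n : ZMod d) * s) := by
  induction n with
  | zero => simp [shift_zero]
  | succ n ih => rw [pow_succ, ih, shift_mul_shift, Nat.cast_succ, add_mul, one_mul]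

theorem shift_mul_shift_of_lt {j k : ℕ} (h : j < k) :
    shift j 1 * shift k 1 = q d • (shift k 1 * shift j (1 : ZMod d)) := by
  refine Finsupp.lhom_ext fun a z => ?_
  rw [LinearMap.smul_apply, Module.End.mul_apply, Module.End.mul_apply]
  simp only [shift_single, sum_range_add_single, if_pos h, if_neg h.le.not_gt, Finsupp.smul_single,
    smul_eq_mul, ← phase_one, ← mul_assoc, ← AddChar.map_add_eq_mul]
  rw [add_right_comm]
  congr 3
  ring

/-- The representation of the parafermion algebra on the vector space with a basis vector for each
ordered monomial. -/
def regular (d : ℕ) [NeZero d] : PF d ℕ →ₐ[ℂ] Module.End ℂ ((ℕ →₀ ZMod d) →₀ ℂ) :=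
  RingQuot.liftAlgHom ℂ ⟨FreeAlgebra.lift ℂ fun g => match g with
    | .c j => shift j 1
    | .cstar j => shift j (-1), by
      intro x y h
      cases h with
      | comm j k h => simpa using shift_mul_shift_of_lt h
      | pow j => simp [shift_pow, shift_zero]
      | mul_star j => simp [shift_mul_shift, shift_zero]
      | star_mul j => simp [shift_mul_shift, shift_zero]⟩

theorem regular_c (j : ℕ) : regular d (c d j) = shift j 1 := by
  change RingQuot.liftAlgHom ℂ _ (RingQuot.mkAlgHom ℂ (Rel d ℕ) _) = _
  rw [RingQuot.liftAlgHom_mkAlgHom_apply, FreeAlgebra.lift_ι_apply]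

theorem regular_cpow (j : ℕ) (s : ZMod d) : regular d (cpow j s) = shift j s := by
  rw [cpow, map_pow, regular_c, shift_pow, mul_one, ZMod.natCast_zmod_val]

/-- The factor of largest index acts first, and each factor meets a vector with no exponents below
its own index, so no phase arises. For `b = 0`, distinct exponents thus give distinct basis vectors.
The induction needs general `b`. -/
theorem regular_monomial (a : ℕ → ZMod d) (N : ℕ) (b : ℕ →₀ ZMod d) (hb : ∀ i < N, b i = 0) :
    regular d (monomial a N) (Finsupp.single b 1)
      = Finsupp.single (b + ∑ i ∈ Finset.range N, Finsupp.single i (a i)) 1 := by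
  induction N generalizing b with
  | zero => simp
  | succ N ih =>
    rw [monomial_succ, map_mul, Module.End.mul_apply, regular_cpow, shift_single,
      Finset.sum_eq_zero fun i hi => hb i (by rw [Finset.mem_range] at hi; omega), mul_zero,
      neg_zero, AddChar.map_zero_eq_one, one_mul, ih, Finset.sum_range_succ, add_assoc,
      add_comm (Finsupp.single N _)]
    intro i hi
    simp [hb i (by omega), hi.ne']

/-- The value on an ordered monomial of the product of the functionals `ρ`. -/
def productValue (ρ : PF d (Fin 2) →ₗ[ℂ] ℂ) (a : ℕ →₀ ZMod d) : ℂ :=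
  ∏ k ∈ Finset.range (a.support.sup id + 1), ρ (pairMonomial (a (2 * k)) (a (2 * k + 1)))

/-- The cutoff is immaterial, since pairs with zero exponents contribute `ρ 1 = 1`. -/
theorem productValue_eq {ρ : PF d (Fin 2) →ₗ[ℂ] ℂ} (hρ : ρ 1 = 1) (a : ℕ →₀ ZMod d) {n : ℕ}
    (h : ∀ i, 2 * n ≤ i → a i = 0) :
    productValue ρ a = ∏ k ∈ Finset.range n, ρ (pairMonomial (a (2 * k)) (a (2 * k + 1))) := by
  have h1 : ∀ s t : ZMod d, s = 0 → t = 0 → ρ (pairMonomial s t) = 1 := by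
    rintro _ _ rfl rfl
    simp [pairMonomial, hρ]
  have h2 : ∀ i, a.support.sup id + 1 ≤ i → a i = 0 := by
    intro i hi
    by_contra hne
    have := Finset.le_sup (f := id) (Finsupp.mem_support_iff.mpr hne)
    simp only [id] at this
    omega
  rw [productValue]
  rcases le_total (a.support.sup id + 1) n with hn | hn
  · exact (Finset.eventually_constant_prod
      (fun k hk => h1 _ _ (h2 _ (by omega)) (h2 _ (by omega))) hn).symm
  · exact Finset.eventually_constant_prod
      (fun k hk => h1 _ _ (h _ (by omega)) (h _ (by omega))) hn

/-- The product of the functionals `ρ`. -/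
def productFunctional (ρ : PF d (Fin 2) →ₗ[ℂ] ℂ) : PF d ℕ →ₗ[ℂ] ℂ :=
  Finsupp.linearCombination ℂ (productValue ρ) ∘ₗ
    LinearMap.applyₗ (Finsupp.single 0 1) ∘ₗ (regular d).toLinearMap

theorem productFunctional_monomial {ρ : PF d (Fin 2) →ₗ[ℂ] ℂ} (hρ : ρ 1 = 1) (a : ℕ → ZMod d)
    (n : ℕ) : productFunctional ρ (monomial a (2 * n))
      = ∏ k ∈ Finset.range n, ρ (pairMonomial (a (2 * k)) (a (2 * k + 1))) := by
  have key : ∀ i, (∑ i ∈ Finset.range (2 * n), Finsupp.single i (a i) : ℕ →₀ ZMod d) i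
      = if i < 2 * n then a i else 0 := by
    intro i
    simp [Finsupp.finsetSum_apply, Finsupp.single_apply]
  have h : productFunctional ρ (monomial a (2 * n)) = Finsupp.linearCombination ℂ (productValue ρ)
      (regular d (monomial a (2 * n)) (Finsupp.single 0 1)) := rfl
  rw [h, regular_monomial _ _ _ fun i _ => rfl, Finsupp.linearCombination_single, one_smul,
    zero_add, productValue_eq hρ _ (n := n) fun i hi => by rw [key, if_neg (by omega)]]
  refine Finset.prod_congr rfl fun k hk => ?_
  rw [Finset.mem_range] at hk
  rw [key, key, if_pos (by omega), if_pos (by omega)]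

end Regular

/-! ### Product states -/

section Product

open scoped ComplexOrder

variable {d : ℕ} [NeZero d]

/-- `φ` is given on the ordered monomials as the product of the functionals `ρ`. -/
def IsMonomialProduct (ρ : PF d (Fin 2) →ₗ[ℂ] ℂ) (φ : PF d ℕ →ₗ[ℂ] ℂ) : Prop :=
  ∀ (a : ℕ → ZMod d) (n : ℕ), φ (monomial a (2 * n))
    = ∏ k ∈ Finset.range n, ρ (pairMonomial (a (2 * k)) (a (2 * k + 1)))

theorem monomial_eq_prod_ofFn (a : ℕ → ZMod d) (n : ℕ) : monomial a (2 * n)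
    = (List.ofFn fun k : Fin n => site d k (pairMonomial (a (2 * k)) (a (2 * k + 1)))).prod := by
  induction n with
  | zero => simp
  | succ n ih => simp [monomial_two_mul_succ, ih, List.ofFn_succ', -List.ofFn_succ]

theorem IsInfiniteProduct.isMonomialProduct {ρ : StarAlgState (PF d (Fin 2))}
    {φ : StarAlgState (PF d ℕ)} (h : IsInfiniteProduct ρ φ) :
    IsMonomialProduct ρ.toLinearMap φ.toLinearMap := by
  intro a n
  rw [monomial_eq_prod_ofFn, h n, Finset.prod_range]

theorem star_site_mul_monomial (s t : ZMod d) (a : ℕ → ZMod d) (n : ℕ) :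
    star (site d n (pairMonomial s t)) * monomial a (2 * n)
      = phase d ((s + t) * ∑ i ∈ Finset.range (2 * n), a i) •
        (monomial a (2 * n) * site d n (star (pairMonomial s t))) := by
  have h : site d n (star (pairMonomial s t)) = cpow (2 * n + 1) (-t) * cpow (2 * n) (-s) := by
    rw [pairMonomial, star_mul, star_cpow, star_cpow, map_mul, site, map_cpow, map_cpow]
    rfl
  rw [h, site_pairMonomial, star_mul, star_cpow, star_cpow, mul_assoc,
    cpow_mul_monomial a le_rfl, mul_smul_comm, ← mul_assoc, cpow_mul_monomial a (by omega),
    smul_mul_assoc, smul_smul, ← AddChar.map_add_eq_mul, mul_assoc]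
  congr 2
  ring

namespace IsMonomialProduct

variable {ρ : PF d (Fin 2) →ₗ[ℂ] ℂ} {φ ψ : PF d ℕ →ₗ[ℂ] ℂ}

theorem unique (h : IsMonomialProduct ρ φ) (h' : IsMonomialProduct ρ ψ) : φ = ψ := by
  ext x
  obtain ⟨n, hn⟩ := exists_mem_firstPairs x
  refine LinearMap.eqOn_span ?_ hn
  rintro _ ⟨a, rfl⟩
  exact (h a n).trans (h' a n).symm

theorem apply_monomial_mul_site (h : IsMonomialProduct ρ φ) (a : ℕ → ZMod d) (n : ℕ)
    (s t : ZMod d) :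
    φ (monomial a (2 * n) * site d n (pairMonomial s t))
      = φ (monomial a (2 * n)) * ρ (pairMonomial s t) := by
  let b : ℕ → ZMod d := fun i => if i = 2 * n then s else if i = 2 * n + 1 then t else a i
  have hb : ∀ i < 2 * n, a i = b i := fun i hi => by
    simp only [b]; rw [if_neg (by omega), if_neg (by omega)]
  have h1 : b (2 * n) = s := by simp [b]
  have h2 : b (2 * n + 1) = t := by simp [b]
  rw [monomial_congr hb, ← h1, ← h2, ← monomial_two_mul_succ, h, h, Finset.prod_range_succ]

theorem apply_mul_site (h : IsMonomialProduct ρ φ) {n : ℕ} {y : PF d ℕ} (hy : y ∈ firstPairs d n)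
    (x : PF d (Fin 2)) : φ (y * site d n x) = φ y * ρ x := by
  have hx : x ∈ Submodule.span ℂ (Set.range fun p : ZMod d × ZMod d => pairMonomial p.1 p.2) :=
    span_pairMonomial (d := d) ▸ Submodule.mem_top
  induction hx using Submodule.span_induction with
  | mem x hx =>
    obtain ⟨⟨s, t⟩, rfl⟩ := hx
    induction hy using Submodule.span_induction with
    | mem y hy =>
      obtain ⟨a, rfl⟩ := hy
      exact h.apply_monomial_mul_site a n s t
    | zero => simp
    | add x y _ _ hx hy => rw [add_mul, map_add, hx, hy, map_add, add_mul]
    | smul r x _ hx => rw [smul_mul_assoc, map_smul, hx, map_smul, smul_mul_assoc]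
  | zero => simp
  | add x y _ _ hx hy => rw [map_add, mul_add, map_add, hx, hy, map_add, mul_add]
  | smul r x _ hx => rw [map_smul, mul_smul_comm, map_smul, hx, map_smul, mul_smul_comm]

theorem apply_one (h : IsMonomialProduct ρ φ) : φ 1 = 1 := by simpa using h 0 0

/-- A product functional satisfies the product rule with gaps between the factors. -/
theorem apply_mul_site_of_le (h : IsMonomialProduct ρ φ) {n k : ℕ} (hnk : n ≤ k) {y : PF d ℕ}
    (hy : y ∈ firstPairs d n) (x : PF d (Fin 2)) : φ (y * site d k x) = φ y * ρ x :=
  h.apply_mul_site (firstPairs_mono hnk hy) x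

theorem apply_prod_ofFn (h : IsMonomialProduct ρ φ) (n : ℕ) (x : Fin n → PF d (Fin 2)) :
    φ (List.ofFn fun k : Fin n => site d k (x k)).prod = ∏ k, ρ (x k) := by
  have key : ∀ (n : ℕ) (x : Fin n → PF d (Fin 2)),
      (List.ofFn fun k : Fin n => site d k (x k)).prod ∈ firstPairs d n ∧
      φ (List.ofFn fun k : Fin n => site d k (x k)).prod = ∏ k, ρ (x k) := by
    intro n
    induction n with
    | zero => exact fun x => ⟨by simpa using monomial_mem_firstPairs (0 : ℕ → ZMod d) 0,
        by simpa using h.apply_one⟩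
    | succ n ih =>
      intro x
      obtain ⟨h1, h2⟩ := ih fun k => x k.castSucc
      have e : (List.ofFn fun k : Fin (n + 1) => site d k (x k)).prod
          = (List.ofFn fun k : Fin n => site d k (x k.castSucc)).prod
            * site d n (x (Fin.last n)) := by
        simp [List.ofFn_succ', -List.ofFn_succ]
      rw [e]
      refine ⟨mul_site_mem_firstPairs h1 _, ?_⟩
      rw [h.apply_mul_site h1, h2, Fin.prod_univ_castSucc]
  exact (key n x).2

/-- A nonzero total charge forces some pair to have nonzero charge, and its factor in the product
vanishes. -/
theorem apply_eq_zero (h : IsMonomialProduct ρ φ)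
    (hρ : ∀ s t : ZMod d, s + t ≠ 0 → ρ (pairMonomial s t) = 0) {a : ℕ → ZMod d} {n : ℕ}
    (ha : ∑ i ∈ Finset.range (2 * n), a i ≠ 0) : φ (monomial a (2 * n)) = 0 := by
  have h1 : ∑ i ∈ Finset.range (2 * n), a i
      = ∑ k ∈ Finset.range n, (a (2 * k) + a (2 * k + 1)) := by
    clear ha
    induction n with
    | zero => simp
    | succ n ih =>
      rw [Finset.sum_range_succ _ n, ← ih, show 2 * (n + 1) = 2 * n + 1 + 1 by ring,
        Finset.sum_range_succ, Finset.sum_range_succ, add_assoc]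
  rw [h1] at ha
  obtain ⟨k, hk, hne⟩ := Finset.exists_ne_zero_of_sum_ne_zero ha
  rw [h]
  exact Finset.prod_eq_zero hk (hρ _ _ hne)

/-- This factorization is what makes positivity pass from `ρ` to the product, and it is here that
neutrality removes the phases. -/
theorem apply_star_monomial_mul (h : IsMonomialProduct ρ φ)
    (hρ : ∀ s t : ZMod d, s + t ≠ 0 → ρ (pairMonomial s t) = 0) (a b : ℕ → ZMod d) (n : ℕ) :
    φ (star (monomial a (2 * n)) * monomial b (2 * n))
      = ∏ k ∈ Finset.range n, ρ (star (pairMonomial (a (2 * k)) (a (2 * k + 1)))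
          * pairMonomial (b (2 * k)) (b (2 * k + 1))) := by
  induction n with
  | zero => simpa using h.apply_one
  | succ n ih =>
    obtain ⟨z, hz⟩ := exists_star_monomial_mul a b (2 * n)
    rw [Finset.prod_range_succ, ← ih, monomial_two_mul_succ, monomial_two_mul_succ, star_mul,
      mul_assoc, ← mul_assoc (star (monomial a _)), hz, smul_mul_assoc, mul_smul_comm, ← mul_assoc,
      star_site_mul_monomial, smul_mul_assoc, mul_assoc, ← map_mul, map_smul, map_smul, map_smul,
      h.apply_mul_site (monomial_mem_firstPairs _ _), ← smul_mul_assoc, ← smul_mul_assoc]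
    congr 2
    -- The inner product of earlier pairs has charge `∑ (b - a) i`. If this is zero, the phase is
    -- `1`; otherwise `φ` vanishes on it and the phase is irrelevant.
    by_cases hE : ∑ i ∈ Finset.range (2 * n), (b - a) i = 0
    · rw [hE, mul_zero, AddChar.map_zero_eq_one, one_smul]
    · rw [h.apply_eq_zero hρ hE, smul_zero]

theorem nonneg (h : IsMonomialProduct ρ φ)
    (hρ : ∀ s t : ZMod d, s + t ≠ 0 → ρ (pairMonomial s t) = 0)
    (hpos : ∀ x, 0 ≤ ρ (star x * x)) (hstar : ∀ x, ρ (star x) = star (ρ x)) (x : PF d ℕ) :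
    0 ≤ φ (star x * x) := by
  have gram : ∀ w : (ℕ → ZMod d) → PF d (Fin 2),
      (Matrix.of fun a b => ρ (star (w a) * w b)).PosSemidef := by
    refine fun w => ⟨Matrix.IsHermitian.ext fun a b => ?_, fun v => ?_⟩
    · simp [← hstar]
    · convert hpos (v.sum fun a r => r • w a) using 1
      simp only [Finsupp.sum, star_sum, star_smul, Finset.sum_mul_sum, map_sum, smul_mul_smul_comm,
        map_smul, smul_eq_mul, Matrix.of_apply]
      exact Finset.sum_congr rfl fun _ _ => Finset.sum_congr rfl fun _ _ => mul_right_comm _ _ _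
  have posSemidef : ∀ n, (Matrix.of fun a b : ℕ → ZMod d =>
      φ (star (monomial a (2 * n)) * monomial b (2 * n))).PosSemidef := by
    intro n
    simp only [h.apply_star_monomial_mul hρ]
    induction n with
    | zero =>
      refine ⟨Matrix.IsHermitian.ext fun a b => by simp, fun v => ?_⟩
      -- The empty product gives the all-ones matrix, whose quadratic form is the squared modulus of
      -- the sum of the coefficients.
      simpa [Finsupp.sum, Finset.sum_mul_sum] using star_mul_self_nonneg (v.sum fun _ r => r)
    | succ n ih =>
      simp only [Finset.prod_range_succ]
      exact ih.hadamard (gram fun a => pairMonomial (a (2 * n)) (a (2 * n + 1)))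
  obtain ⟨n, hn⟩ := exists_mem_firstPairs x
  obtain ⟨v, rfl⟩ := Finsupp.mem_span_range_iff_exists_finsupp.mp hn
  convert (posSemidef n).2 v using 1
  simp only [Finsupp.sum, star_sum, star_smul, Finset.sum_mul_sum, map_sum, smul_mul_smul_comm,
    map_smul, smul_eq_mul, Matrix.of_apply]
  exact Finset.sum_congr rfl fun _ _ => Finset.sum_congr rfl fun _ _ => mul_right_comm _ _ _

end IsMonomialProduct

theorem existsUnique_isInfiniteProduct {ρ : StarAlgState (PF d (Fin 2))} (hρ : IsNeutral ρ) :
    ∃! φ : StarAlgState (PF d ℕ), IsInfiniteProduct ρ φ := by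
  have h : IsMonomialProduct ρ.toLinearMap (productFunctional ρ.toLinearMap) :=
    productFunctional_monomial ρ.map_one'
  refine ⟨⟨productFunctional ρ.toLinearMap,
    h.nonneg (fun s t => hρ.apply_pairMonomial) ρ.nonneg' ρ.map_star, h.apply_one⟩,
    h.apply_prod_ofFn, fun ψ hψ => ?_⟩
  obtain ⟨f, _, _⟩ := ψ
  congr 1
  exact hψ.isMonomialProduct.unique h

end Product

end PF

/-! ### Central elements of the GNS von Neumann algebra -/

namespace StarAlgState

open scoped ComplexOrder InnerProductSpace
open UniformSpace Filter Topology

section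

variable {A : Type*} [Ring A] [StarRing A] [Algebra ℂ A]

theorem average_comm (φ ψ : StarAlgState A) : φ.average ψ = ψ.average φ := by
  simp only [average, add_comm]

variable [StarModule ℂ A]

theorem norm_toPreGNS_sq (φ : StarAlgState A) (a : A) :
    ‖φ.toPreGNS a‖ ^ 2 = (φ (star a * a)).re := by
  rw [← inner_toPreGNS, ← inner_self_eq_norm_sq (𝕜 := ℂ)]
  rfl

theorem norm_toPreGNS_unitary_mul (φ : StarAlgState A) {u : A} (hu : u ∈ unitary A) (a : A) :
    ‖φ.toPreGNS (u * a)‖ = ‖φ.toPreGNS a‖ := by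
  rw [← sq_eq_sq₀ (norm_nonneg _) (norm_nonneg _), norm_toPreGNS_sq, norm_toPreGNS_sq, star_mul,
    mul_assoc, ← mul_assoc (star u), (Unitary.mem_iff.mp hu).1, one_mul]

/-- A Radon–Nikodym operator: the bound extends the identity of `A` to a bounded map `I` between the
GNS spaces, and `T = I* I`. -/
theorem exists_inner_eq_of_le (φ ψ : StarAlgState A) {C : ℝ}
    (h : ∀ a, ‖φ.toPreGNS a‖ ≤ C * ‖ψ.toPreGNS a‖) :
    ∃ T : ψ.GNS →L[ℂ] ψ.GNS, ∀ a b : A,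
      ⟪(ψ.toPreGNS a : ψ.GNS), T (ψ.toPreGNS b : ψ.GNS)⟫_ℂ = φ (star a * b) := by
  let I : ψ.PreGNS →L[ℂ] φ.PreGNS :=
    LinearMap.mkContinuous (φ.toPreGNS.toLinearMap ∘ₗ ψ.toPreGNS.symm.toLinearMap) C
      fun x => h (ψ.toPreGNS.symm x)
  have hI : ∀ a, I.completion (ψ.toPreGNS a : ψ.GNS) = (φ.toPreGNS a : φ.GNS) := fun a =>
    I.completion_apply_coe _
  refine ⟨ContinuousLinearMap.adjoint I.completion ∘L I.completion, fun a b => ?_⟩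
  rw [ContinuousLinearMap.comp_apply, ContinuousLinearMap.adjoint_inner_right, hI, hI,
    Completion.inner_coe, inner_toPreGNS]

/-- Positivity of `ψ` gives `φ (a* a) ≤ 2 * average (a* a)`; the constant `2` on norms, which
squares to `4`, is more than enough. -/
theorem norm_le_average_left (φ ψ : StarAlgState A) (a : A) :
    ‖φ.toPreGNS a‖ ≤ 2 * ‖(φ.average ψ).toPreGNS a‖ := by
  rw [← sq_le_sq₀ (norm_nonneg _) (by positivity), mul_pow, norm_toPreGNS_sq, norm_toPreGNS_sq]
  have h1 := (Complex.le_def.mp (φ.nonneg' a)).1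
  have h2 := (Complex.le_def.mp (ψ.nonneg' a)).1
  simp only [average, LinearMap.smul_apply, LinearMap.add_apply, smul_eq_mul, Complex.mul_re,
    Complex.add_re, Complex.zero_re] at h1 h2 ⊢
  norm_num
  linarith

theorem tendsto_inner_of_forall_coe (ψ : StarAlgState A) {w : ℕ → ψ.GNS} {w₀ : ψ.GNS} {C : ℝ}
    (hC : ∀ k, ‖w k‖ ≤ C)
    (h : ∀ a : A, Tendsto (fun k => ⟪(ψ.toPreGNS a : ψ.GNS), w k⟫_ℂ) atTop
      (𝓝 ⟪(ψ.toPreGNS a : ψ.GNS), w₀⟫_ℂ)) (v : ψ.GNS) :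
    Tendsto (fun k => ⟪v, w k⟫_ℂ) atTop (𝓝 ⟪v, w₀⟫_ℂ) := by
  rw [Metric.tendsto_atTop]
  intro ε hε
  -- The summand `1` only makes the bound on `‖w k - w₀‖` strictly positive, so that it can be
  -- divided by.
  have hD : 0 < C + ‖w₀‖ + 1 := by
    have := (norm_nonneg _).trans (hC 0)
    positivity
  obtain ⟨_, ⟨x, rfl⟩, hx⟩ := Metric.mem_closure_iff.mp
    ((Completion.denseRange_coe (α := ψ.PreGNS)).closure_range ▸ Set.mem_univ v)
    (ε / 2 / (C + ‖w₀‖ + 1)) (by positivity)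
  obtain ⟨N, hN⟩ := Metric.tendsto_atTop.mp (h (ψ.toPreGNS.symm x)) (ε / 2) (by positivity)
  refine ⟨N, fun k hk => ?_⟩
  have h1 := hN k hk
  rw [dist_eq_norm, ← inner_sub_right] at h1 ⊢
  rw [dist_eq_norm, lt_div_iff₀ hD] at hx
  have h2 : ⟪v, w k - w₀⟫_ℂ = ⟪v - x, w k - w₀⟫_ℂ + ⟪(x : ψ.GNS), w k - w₀⟫_ℂ := by
    rw [← inner_add_left, sub_add_cancel]
  have h3 : ‖w k - w₀‖ ≤ C + ‖w₀‖ + 1 := by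
    have := norm_sub_le (w k) w₀
    have := hC k
    linarith
  calc ‖⟪v, w k - w₀⟫_ℂ‖ ≤ ‖⟪v - x, w k - w₀⟫_ℂ‖ + ‖⟪(x : ψ.GNS), w k - w₀⟫_ℂ‖ := by
        rw [h2]; exact norm_add_le _ _
    _ < ε / 2 + ε / 2 := by
        refine add_lt_add_of_le_of_lt ?_ h1
        refine (norm_inner_le_norm _ _).trans (le_trans ?_ hx.le)
        exact mul_le_mul_of_nonneg_left h3 (norm_nonneg _)
    _ = ε := add_halves ε

theorem inner_coe_ext (ψ : StarAlgState A) {v w : ψ.GNS}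
    (h : ∀ a : A, ⟪(ψ.toPreGNS a : ψ.GNS), v⟫_ℂ = ⟪(ψ.toPreGNS a : ψ.GNS), w⟫_ℂ) : v = w := by
  refine ext_inner_left ℂ fun x => ?_
  induction x using Completion.induction_on with
  | hp => apply isClosed_eq <;> fun_prop
  | ih x => exact h (ψ.toPreGNS.symm x)

variable [SpannedByUnitaries A]

theorem inner_gnsRep_left (ψ : StarAlgState A) (a : A) (v w : ψ.GNS) :
    ⟪v, ψ.gnsRep a w⟫_ℂ = ⟪ψ.gnsRep (star a) v, w⟫_ℂ := by
  rw [StarHomClass.map_star, ContinuousLinearMap.star_eq_adjoint, ContinuousLinearMap.adjoint_inner_left]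

theorem gnsRep_coe (ψ : StarAlgState A) (a b : A) :
    ψ.gnsRep a (ψ.toPreGNS b : ψ.GNS) = (ψ.toPreGNS (a * b) : ψ.GNS) := ψ.gnsOp_coe a b

/-- If left multiplication by unitaries `u k` converges weakly to an operator that represents a
linear functional `F` with respect to `ψ`, and the von Neumann algebra of `ψ` is a factor, then `F`
is a multiple of `ψ`. -/
theorem exists_eq_smul_of_isFactor (ψ : StarAlgState A) (hψ : ψ.gnsVonNeumannAlgebra.IsFactor)
    (F : A → ℂ) (Z : ψ.GNS →L[ℂ] ψ.GNS)
    (hZ : ∀ a b : A, ⟪(ψ.toPreGNS a : ψ.GNS), Z (ψ.toPreGNS b : ψ.GNS)⟫_ℂ = F (star a * b))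
    (u : ℕ → A) (hu : ∀ k, u k ∈ unitary A)
    (hF : ∀ a b : A, ∀ᶠ k in atTop, ψ (star a * (u k * b)) = F (star a * b)) :
    ∃ z : ℂ, ∀ a, F a = z * ψ a := by
  -- Both orders of multiplication have matrix coefficients `F (b'* a b)`.
  have hcomm : Z ∈ Set.centralizer (Set.range ψ.gnsRep) := by
    rintro _ ⟨a, rfl⟩
    refine ψ.gnsOp_ext fun b => ψ.inner_coe_ext fun b' => ?_
    rw [mul_apply_eq_comp, mul_apply_eq_comp, inner_gnsRep_left, gnsRep_coe,
      gnsRep_coe, hZ, hZ, star_mul, star_star, mul_assoc]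
  -- An operator `S` in the commutant satisfies `⟨S* a, u k b⟩ = ⟨(u k)* a, S b⟩`. Letting `k → ∞`
  -- on both sides gives `⟨a, S Z b⟩ = ⟨a, Z S b⟩`. Unitarity of `u k` supplies the uniform bounds
  -- for weak convergence.
  have hmem : Z ∈ (ψ.gnsVonNeumannAlgebra : Set (ψ.GNS →L[ℂ] ψ.GNS)) := by
    rw [coe_gnsVonNeumannAlgebra]
    intro S hS
    refine ψ.gnsOp_ext fun b => ψ.inner_coe_ext fun a => ?_
    have hS' : ∀ k, ⟪ContinuousLinearMap.adjoint S (ψ.toPreGNS a : ψ.GNS),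
        (ψ.toPreGNS (u k * b) : ψ.GNS)⟫_ℂ
        = ⟪(ψ.toPreGNS (star (u k) * a) : ψ.GNS), S (ψ.toPreGNS b : ψ.GNS)⟫_ℂ := by
      intro k
      have h := congrArg (fun f : ψ.GNS →L[ℂ] ψ.GNS => f (ψ.toPreGNS b : ψ.GNS))
        (hS _ ⟨u k, rfl⟩)
      simp only [mul_apply_eq_comp] at h
      rw [ContinuousLinearMap.adjoint_inner_left, ← gnsRep_coe, ← h, inner_gnsRep_left, gnsRep_coe]
    have h1 := ψ.tendsto_inner_of_forall_coe (w := fun k => (ψ.toPreGNS (u k * b) : ψ.GNS))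
      (w₀ := Z (ψ.toPreGNS b : ψ.GNS)) (C := ‖ψ.toPreGNS b‖)
      (fun k => by rw [Completion.norm_coe, norm_toPreGNS_unitary_mul _ (hu k)])
      (fun a' => tendsto_const_nhds.congr' <| (hF a' b).mono fun k hk => by
        beta_reduce
        rw [hZ, Completion.inner_coe, inner_toPreGNS, hk])
      (ContinuousLinearMap.adjoint S (ψ.toPreGNS a : ψ.GNS))
    have h2 := ψ.tendsto_inner_of_forall_coe (w := fun k => (ψ.toPreGNS (star (u k) * a) : ψ.GNS))
      (w₀ := ContinuousLinearMap.adjoint Z (ψ.toPreGNS a : ψ.GNS)) (C := ‖ψ.toPreGNS a‖)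
      (fun k => by
        rw [Completion.norm_coe, norm_toPreGNS_unitary_mul _ (Unitary.star_mem (hu k))])
      (fun b' => tendsto_const_nhds.congr' <| (hF a b').mono fun k hk => by
        beta_reduce
        rw [ContinuousLinearMap.adjoint_inner_right, ← inner_conj_symm, hZ, ← hk,
          ← inner_conj_symm (ψ.toPreGNS b' : ψ.GNS), Completion.inner_coe, inner_toPreGNS, star_mul,
          star_star, mul_assoc])
      (S (ψ.toPreGNS b : ψ.GNS))
    have h3 := (Complex.continuous_conj.tendsto _).comp h2
    simp only [Function.comp_def, inner_conj_symm, ← hS'] at h3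
    have h4 := tendsto_nhds_unique h1 h3
    rwa [ContinuousLinearMap.adjoint_inner_left, ContinuousLinearMap.adjoint_inner_left] at h4
  have hcenter : Z ∈ (ψ.gnsVonNeumannAlgebra : Set (ψ.GNS →L[ℂ] ψ.GNS))
      ∩ ψ.gnsVonNeumannAlgebra.commutant := by
    refine ⟨hmem, ?_⟩
    rw [SetLike.mem_coe, VonNeumannAlgebra.mem_commutant_iff]
    intro g hg
    rw [← SetLike.mem_coe, coe_gnsVonNeumannAlgebra] at hg
    exact (hg Z hcomm).symm
  rw [VonNeumannAlgebra.IsFactor] at hψ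
  rw [hψ] at hcenter
  obtain ⟨z, rfl⟩ := hcenter
  refine ⟨z, fun a => ?_⟩
  have h := hZ 1 a
  rw [star_one, one_mul] at h
  rw [← h, Algebra.algebraMap_eq_smul_one, smul_apply,
    one_apply_eq_self, inner_smul_right, Completion.inner_coe, inner_toPreGNS, star_one,
    one_mul]

end

end StarAlgState

/-! ### Weak limits of neutral monomials and non-factoriality -/

namespace PF

open Filter

variable {d : ℕ} [NeZero d]

/-- Both states vanish on charged monomials, so any difference shows on one of charge zero, as is
needed for its copies to commute with earlier pairs. -/
theorem exists_pairMonomial_ne {ρ τ : StarAlgState (PF d (Fin 2))} (hρ : IsNeutral ρ)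
    (hτ : IsNeutral τ) (hne : ρ ≠ τ) :
    ∃ s t : ZMod d, s + t = 0 ∧ ρ (pairMonomial s t) ≠ τ (pairMonomial s t) := by
  by_contra! h
  refine hne ?_
  have key : ρ.toLinearMap = τ.toLinearMap := by
    refine LinearMap.ext_on_range span_pairMonomial fun p => ?_
    by_cases hp : p.1 + p.2 = 0
    · exact h _ _ hp
    · rw [hρ.apply_pairMonomial hp, hτ.apply_pairMonomial hp]
  obtain ⟨f, _, _⟩ := ρ
  obtain ⟨g, _, _⟩ := τ
  congr 1

theorem not_isFactor_average {ρ τ : StarAlgState (PF d (Fin 2))} (hρ : IsNeutral ρ)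
    (hτ : IsNeutral τ) (hne : ρ ≠ τ) {Φ T : StarAlgState (PF d ℕ)} (hΦ : IsInfiniteProduct ρ Φ)
    (hT : IsInfiniteProduct τ T) : ¬ (Φ.average T).gnsVonNeumannAlgebra.IsFactor := by
  intro hfactor
  obtain ⟨s, t, hst, hx⟩ := exists_pairMonomial_ne hρ hτ hne
  set x := pairMonomial s t with hxdef
  obtain ⟨P, hP⟩ := Φ.exists_inner_eq_of_le (Φ.average T) (Φ.norm_le_average_left T)
  obtain ⟨Q, hQ⟩ := T.exists_inner_eq_of_le (Φ.average T)
    (by rw [Φ.average_comm T]; exact T.norm_le_average_left Φ)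
  have hav : ∀ y, Φ.average T y = 1 / 2 * (Φ y + T y) := fun y => rfl
  obtain ⟨z, hz⟩ := (Φ.average T).exists_eq_smul_of_isFactor hfactor
    (fun y => 1 / 2 * (Φ y * ρ x + T y * τ x)) ((1 / 2 * ρ x) • P + (1 / 2 * τ x) • Q)
    (fun a b => by
      rw [add_apply, smul_apply,
        smul_apply, inner_add_right, inner_smul_right, inner_smul_right, hP, hQ]
      ring)
    (fun k => site d k x)
    (fun k => by
      rw [hxdef, site_pairMonomial]
      exact mul_mem (cpow_mem_unitary _ _) (cpow_mem_unitary _ _))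
    (fun a b => by
      obtain ⟨m, hm⟩ := exists_mem_firstPairs b
      obtain ⟨n, hn⟩ := exists_mem_firstPairs (star a * b)
      -- The bound `m ≤ k` lets the copy of `x` pass `b`; the bound `n ≤ k` lets the product rule
      -- split it off `star a * b`.
      filter_upwards [eventually_ge_atTop m, eventually_ge_atTop n] with k hmk hnk
      rw [(commute_site_pairMonomial hst hmk hm).eq, ← mul_assoc, hav,
        hΦ.isMonomialProduct.apply_mul_site_of_le hnk hn,
        hT.isMonomialProduct.apply_mul_site_of_le hnk hn])
  have h1 := hz 1
  have h2 := hz (site d 0 x)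
  have hone : (1 : PF d ℕ) ∈ firstPairs d 0 := monomial_mem_firstPairs (0 : ℕ → ZMod d) 0
  have h3 := hΦ.isMonomialProduct.apply_mul_site hone x
  have h4 := hT.isMonomialProduct.apply_mul_site hone x
  rw [one_mul, hΦ.isMonomialProduct.apply_one, one_mul] at h3
  rw [one_mul, hT.isMonomialProduct.apply_one, one_mul] at h4
  simp only [hav, h3, h4, hΦ.isMonomialProduct.apply_one, hT.isMonomialProduct.apply_one] at h1 h2
  refine hx (sub_eq_zero.mp (pow_eq_zero_iff two_ne_zero |>.mp ?_))
  -- Eliminating `z` leaves `2 * (ρ x ^ 2 + τ x ^ 2) - (ρ x + τ x) ^ 2 = (ρ x - τ x) ^ 2`.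
  linear_combination 4 * h2 - 2 * (ρ x + τ x) * h1

end PF

end

theorem mainTheorem9 (d : ℕ) (hd : Squarefree d) (ρ τ : StarAlgState (PF d (Fin 2)))
    (hρ : PF.IsNeutral ρ) (hτ : PF.IsNeutral τ) (hne : ρ ≠ τ) :
    (∃! Φ : StarAlgState (PF d ℕ), PF.IsInfiniteProduct ρ Φ) ∧
    (∃! T : StarAlgState (PF d ℕ), PF.IsInfiniteProduct τ T) ∧
    ∀ Φ T : StarAlgState (PF d ℕ), PF.IsInfiniteProduct ρ Φ → PF.IsInfiniteProduct τ T →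
      ¬ (Φ.average T).gnsVonNeumannAlgebra.IsFactor := by
  have : NeZero d := ⟨hd.ne_zero⟩
  exact ⟨PF.existsUnique_isInfiniteProduct hρ, PF.existsUnique_isInfiniteProduct hτ,
    fun _ _ => PF.not_isFactor_average hρ hτ hne⟩
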